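/- Let $N\ge 3$ be an odd integer. Subsets of $[1,N]=\{1,\dots,N\}$ form an $\mathbb F_2$-vector space under symmetric difference, written $+$; $[a,b]=\{h\in\mathbb Z: a\le h\le b\}$. **Configurations.** Let $\mathcal P_N$ be the set of all sets $B$ of pairwise disjoint two-element subsets of $[1,N]$; $\mathrm{supp}(B)$ is the union of the members of $B$, and $B^0$ (resp. $B^1$) is the set of $\{i,j\}\in B$ with $i-j$ even (resp. odd). A set $X$ is *$0$-covered* (by $B^1$) if it is a (possibly empty) disjoint union of intervals $[a,b]$ with $a<b$, $\{a,b\}\in B^1$, and *$1$-covered* if it is the disjoint union of such intervals and of one one-element set. Let ${}^*\mathcal P_N$ be the set of $B\in\mathcal P_N$ such that * for all $\{i,j\}\in B^1$ with $i<j$, $[i+1,j-1]$ is $0$-covered; * there are $i_1<i_2<\dots<i_{2s}$, $s=|B^0|$ (these are unique), with $B^0=\{\{i_1,i_{2s}\},\{i_2,i_{2s-1}\},\dots,\{i_s,i_{s+1}\}\}$, such that $[i_k+1,i_{k+1}-1]$ is $0$-covered for $1\le k<s$ and for $s+1\le k<2s$. For $B\in{}^*\mathcal P_N$ consider the conditions: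 * (I) $s=0$, or $s\ge1$ and both $[1,i_1-1]$ and $[i_{2s}+1,N]$ are $0$-covered. * (II) $N\notin\mathrm{supp}(B)$ and either $s=0$, or $s$ is odd and one of the following holds: (i) $[1,i_1-1]$ is $1$-covered and $[i_{2s}+1,N-1]$ is $0$-covered; (ii) $[1,i_1-1]$ is $0$-covered and $[i_{2s}+1,N-1]$ is $1$-covered. * (III) (I) holds; if $s$ is even then $\{i,N\}\in B$ for some even $i$; if $s$ is odd then $\{i,N\}\in B$ for some odd $i$. Let $\mathcal X^+$ (resp. $\mathcal X^-$) be the set of $B\in{}^*\mathcal P_N$ satisfying (II) (resp. (III)), and $\mathcal X=\mathcal X^+\sqcup\mathcal X^-$. For $B\in\mathcal X^+$ with $s$ odd, let $u_B$ be the unique $u\in[1,i_1-1]$ such that $[1,u-1]$ and $[u+1,i_1-1]$ are $0$-covered in case (i), and the unique $u\in[i_{2s}+1,N-1]$ such that $[i_{2s}+1,u-1]$ and $[u+1,N-1]$ are $0$-covered in case (ii). **The map ${}'\epsilon$ and the relation $\preceq$.** For $i<j$ in $[1,N]$ put $[[\{i,j\}]]=[i,j]$ if $j-i$ is odd and $[[\{i,j\}]]=[j,N]\cup[1,i]$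 if $j-i$ is even. For $B\in\mathcal X$ let ${}'\epsilon(B)=\sum_{Z\in B}[[Z]]+c_B$, where $c_B=[u_B,N]$ if $B\in\mathcal X^+$, $s$ is odd and $u_B$ is even; $c_B=\{N\}+[1,u_B]$ if $B\in\mathcal X^+$, $s$ is odd and $u_B$ is odd; $c_B=\emptyset$ otherwise. This map is a bijection from $\mathcal X$ onto the set of subsets of even cardinality of $[1,N]$. Let $\langle B\rangle$ be the $\mathbb F_2$-span of the members of $B$. For $B',B\in\mathcal X$ write $B'\preceq B$ if there are $h\ge0$ and $B'=B_0,B_1,\dots,B_h=B$ in $\mathcal X$ with ${}'\epsilon(B_k)\in\langle B_{k+1}\rangle$ for $0\le k<h$. For subsets $X',X$ of even cardinality of $[1,N]$ write $X'\preceq X$ if $X'={}'\epsilon(B')$, $X={}'\epsilon(B)$ with $B',B\in\mathcal X$, $B'\preceq B$. **Orbits.** Let $\gamma(X)$ be the number of even elements of $X$ minus the number of odd elements of $X$. Let $E_N^+$ (resp. $E_N^-$) be the set of subsets $X$ of $[1,N]$ of even cardinality with $N\notin X$ (resp. $N\in X$). The involution $X\mapsto X+[1,N-1]$ preserves both sets;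 let $\bar E_N^+,\bar E_N^-$ be the corresponding sets of orbits. Each $Y\in\bar E_N^+$ contains exactly one $X$ with either $\gamma(X)<0$, or $\gamma(X)=0$ and $N-1\notin X$; each $Y\in\bar E_N^-$ contains exactly one $X$ with $\gamma(X)\ge0$. In both cases this element is denoted by $\tilde Y$. For $Y',Y\in\bar E_N^+$ (resp. $\bar E_N^-$) write $Y'\,\bar\preceq\,Y$ if there are $k\ge0$ and $Y'=Y_0,Y_1,\dots,Y_k=Y$ in $\bar E_N^+$ (resp. $\bar E_N^-$) such that, for each $i\in\{0,\dots,k-1\}$, either $\tilde Y_i\preceq\tilde Y_{i+1}$ or $|\gamma(\tilde Y_i)|<|\gamma(\tilde Y_{i+1})|$ (resp. $|\gamma(\tilde Y_i)+1|<|\gamma(\tilde Y_{i+1})+1|$). **Theorem.** $\bar\preceq$ is a partial order on $\bar E_N^+$ and on $\bar E_N^-$. -/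

import Mathlib

namespace OrthBasis

open Finset
open scoped symmDiff

/-! Subsets of `[1, N]` are finsets of natural numbers; the addition of the `𝔽₂`-vector space of
subsets is the symmetric difference. A two-element subset `{a, b}` with `a < b` is encoded as the
pair `(a, b)`. -/

/-- The sum, in the `𝔽₂`-vector space of subsets, of a finite family of subsets. -/
def setSum {ι : Type} (s : Finset ι) (f : ι → Finset ℕ) : Finset ℕ :=
  s.fold (· ∆ ·) ∅ f

/-- The vector in `𝔽₂^ℕ` attached to a finite set. -/
noncomputable def vec (X : Finset ℕ) : ℕ → ZMod 2 :=
  (X : Set ℕ).indicator 1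

/-- The set `𝒫_N` of sets of pairwise disjoint two-element subsets of `[1, N]`. -/
def P (N : ℕ) : Set (Finset (ℕ × ℕ)) :=
  {B | (∀ p ∈ B, 1 ≤ p.1 ∧ p.1 < p.2 ∧ p.2 ≤ N) ∧
    ∀ p ∈ B, ∀ q ∈ B, p ≠ q → Disjoint ({p.1, p.2} : Finset ℕ) {q.1, q.2}}

/-- The union of the members of `B`. -/
def supp (B : Finset (ℕ × ℕ)) : Finset ℕ :=
  B.biUnion fun p => {p.1, p.2}

/-- `B⁰`: the members of `B` whose two elements have the same parity. -/
def part0 (B : Finset (ℕ × ℕ)) : Finset (ℕ × ℕ) :=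
  B.filter fun p => Even (p.2 - p.1)

/-- `B¹`: the members of `B` whose two elements have different parities. -/
def part1 (B : Finset (ℕ × ℕ)) : Finset (ℕ × ℕ) :=
  B.filter fun p => Odd (p.2 - p.1)

/-- `X` is `0`-covered by `B¹`: it is a disjoint union of intervals `[a, b]`, `{a, b} ∈ B¹`
(possibly the empty union). -/
def ZeroCovered (B : Finset (ℕ × ℕ)) (X : Finset ℕ) : Prop :=
  ∃ T ⊆ part1 B, (T : Set (ℕ × ℕ)).PairwiseDisjoint (fun p => Icc p.1 p.2) ∧
    X = T.biUnion fun p => Icc p.1 p.2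

/-- `X` is `1`-covered by `B¹`: it is a disjoint union of intervals `[a, b]`, `{a, b} ∈ B¹`,
and of a one-element set. -/
def OneCovered (B : Finset (ℕ × ℕ)) (X : Finset ℕ) : Prop :=
  ∃ T ⊆ part1 B, (T : Set (ℕ × ℕ)).PairwiseDisjoint (fun p => Icc p.1 p.2) ∧
    ∃ u, u ∉ (T.biUnion fun p => Icc p.1 p.2) ∧ X = insert u (T.biUnion fun p => Icc p.1 p.2)

/-- `i 1 < i 2 < ⋯ < i (2 s)`, `s = |B⁰|`, is the sequence `i_*(B)`, that is,
`B⁰ = {{i 1, i (2 s)}, {i 2, i (2 s - 1)}, …, {i s, i (s + 1)}}`. The values of `i` outside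
`[1, 2 s]` play no role. -/
def IsNest (B : Finset (ℕ × ℕ)) (i : ℕ → ℕ) : Prop :=
  StrictMonoOn i (Set.Icc 1 (2 * #(part0 B))) ∧
    part0 B = (Icc 1 #(part0 B)).image fun k => (i k, i (2 * #(part0 B) + 1 - k))

/-- The set `*𝒫_N`. -/
def PStar (N : ℕ) : Set (Finset (ℕ × ℕ)) :=
  {B | B ∈ P N ∧ (∀ p ∈ part1 B, ZeroCovered B (Icc (p.1 + 1) (p.2 - 1))) ∧
    ∃ i, IsNest B i ∧
      (∀ k, 1 ≤ k → k < #(part0 B) → ZeroCovered B (Icc (i k + 1) (i (k + 1) - 1))) ∧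
      (∀ k, #(part0 B) + 1 ≤ k → k < 2 * #(part0 B) →
        ZeroCovered B (Icc (i k + 1) (i (k + 1) - 1)))}

/-- Condition (I). -/
def CondI (N : ℕ) (B : Finset (ℕ × ℕ)) : Prop :=
  #(part0 B) = 0 ∨ ∃ i, IsNest B i ∧ ZeroCovered B (Icc 1 (i 1 - 1)) ∧
    ZeroCovered B (Icc (i (2 * #(part0 B)) + 1) N)

/-- Condition (i) of (II). -/
def CondIIi (N : ℕ) (B : Finset (ℕ × ℕ)) (i : ℕ → ℕ) : Prop :=
  OneCovered B (Icc 1 (i 1 - 1)) ∧ ZeroCovered B (Icc (i (2 * #(part0 B)) + 1) (N - 1))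

/-- Condition (ii) of (II). -/
def CondIIii (N : ℕ) (B : Finset (ℕ × ℕ)) (i : ℕ → ℕ) : Prop :=
  ZeroCovered B (Icc 1 (i 1 - 1)) ∧ OneCovered B (Icc (i (2 * #(part0 B)) + 1) (N - 1))

/-- Condition (II). -/
def CondII (N : ℕ) (B : Finset (ℕ × ℕ)) : Prop :=
  N ∉ supp B ∧ (#(part0 B) = 0 ∨
    (Odd #(part0 B) ∧ ∃ i, IsNest B i ∧ (CondIIi N B i ∨ CondIIii N B i)))

/-- Condition (III). -/
def CondIII (N : ℕ) (B : Finset (ℕ × ℕ)) : Prop :=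
  CondI N B ∧ (Even #(part0 B) → ∃ j, Even j ∧ (j, N) ∈ B) ∧
    (Odd #(part0 B) → ∃ j, Odd j ∧ (j, N) ∈ B)

/-- `𝒳⁺_{N-2}`. -/
def XPlus (N : ℕ) : Set (Finset (ℕ × ℕ)) := {B | B ∈ PStar N ∧ CondII N B}

/-- `𝒳⁻_{N-2}`. -/
def XMinus (N : ℕ) : Set (Finset (ℕ × ℕ)) := {B | B ∈ PStar N ∧ CondIII N B}

/-- `𝒳_{N-2}`. -/
def X (N : ℕ) : Set (Finset (ℕ × ℕ)) := XPlus N ∪ XMinus N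

/-- The element `u_B`, for `B ∈ 𝒳⁺_{N-2}` with `|B⁰|` odd: the set below then has exactly one
element. -/
noncomputable def uB (N : ℕ) (B : Finset (ℕ × ℕ)) : ℕ :=
  sInf {u | ∃ i, IsNest B i ∧
    ((CondIIi N B i ∧ u ∈ Icc 1 (i 1 - 1) ∧
        ZeroCovered B (Icc 1 (u - 1)) ∧ ZeroCovered B (Icc (u + 1) (i 1 - 1))) ∨
      (CondIIii N B i ∧ u ∈ Icc (i (2 * #(part0 B)) + 1) (N - 1) ∧
        ZeroCovered B (Icc (i (2 * #(part0 B)) + 1) (u - 1)) ∧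
        ZeroCovered B (Icc (u + 1) (N - 1))))}

/-- `[[X]]` for the two-element set `X = {a, b}`, `a < b`. -/
def bracket (N : ℕ) (p : ℕ × ℕ) : Finset ℕ :=
  if Odd (p.2 - p.1) then Icc p.1 p.2 else Icc p.2 N ∪ Icc 1 p.1

open Classical in
/-- The map `'ε` on `𝒳_{N-2}`. -/
noncomputable def eps (N : ℕ) (B : Finset (ℕ × ℕ)) : Finset ℕ :=
  if B ∈ XPlus N ∧ #(part0 B) ≠ 0 then
    if Even (uB N B) then setSum B (bracket N) ∆ Icc (uB N B) N
    else setSum B (bracket N) ∆ Icc N N ∆ Icc 1 (uB N B)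
  else setSum B (bracket N)

/-- The `𝔽₂`-subspace `⟨B⟩` spanned by the members of `B`. -/
noncomputable def spanB (B : Finset (ℕ × ℕ)) : Submodule (ZMod 2) (ℕ → ZMod 2) :=
  Submodule.span (ZMod 2) ((fun p : ℕ × ℕ => vec {p.1, p.2}) '' (B : Set (ℕ × ℕ)))

/-- The relation `⪯` on `𝒳_{N-2}`; `leX N B' B` means `B' ⪯ B`. -/
def leX (N : ℕ) : X N → X N → Prop :=
  Relation.ReflTransGen fun C D => vec (eps N C.1) ∈ spanB D.1

/-- The relation `⪯` on sets, transported from `𝒳_{N-2}` by `'ε`; `leE N Z' Z` means `Z' ⪯ Z`. -/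
def leE (N : ℕ) (Z' Z : Finset ℕ) : Prop :=
  ∃ B' B : X N, eps N B'.1 = Z' ∧ eps N B.1 = Z ∧ leX N B' B

/-- `γ(Z)`: the number of even elements minus the number of odd elements. -/
def gamma (Z : Finset ℕ) : ℤ :=
  (#(Z.filter fun x => Even x) : ℤ) - #(Z.filter fun x => Odd x)

/-- `E_N⁺`: subsets of `[1, N]` of even cardinality not containing `N`. -/
def EPlus (N : ℕ) : Set (Finset ℕ) := {Z | Z ⊆ Icc 1 N ∧ Even #Z ∧ N ∉ Z}

/-- `E_N⁻`: subsets of `[1, N]` of even cardinality containing `N`. -/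
def EMinus (N : ℕ) : Set (Finset ℕ) := {Z | Z ⊆ Icc 1 N ∧ Even #Z ∧ N ∈ Z}

/-- `'E_N⁺`. -/
def EPlus' (N : ℕ) : Set (Finset ℕ) :=
  {Z | Z ∈ EPlus N ∧ (gamma Z < 0 ∨ (gamma Z = 0 ∧ N - 1 ∉ Z))}

/-- `'E_N⁻`. -/
def EMinus' (N : ℕ) : Set (Finset ℕ) := {Z | Z ∈ EMinus N ∧ 0 ≤ gamma Z}

/-- The involution `Z ↦ Z^! = Z + [1, N - 1]`. -/
def bang (N : ℕ) (Z : Finset ℕ) : Finset ℕ := Z ∆ Icc 1 (N - 1)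

theorem bang_bang (N : ℕ) (Z : Finset ℕ) : bang N (bang N Z) = Z := by
  simp [bang]

/-- Being in the same orbit of `Z ↦ Z^!`. -/
def orbitSetoid (N : ℕ) (S : Set (Finset ℕ)) : Setoid S where
  r Z W := W.1 = Z.1 ∨ W.1 = bang N Z.1
  iseqv :=
    { refl := fun _ => Or.inl rfl
      symm := by
        rintro Z W (h | h)
        · exact Or.inl h.symm
        · exact Or.inr (by rw [h, bang_bang])
      trans := by
        rintro Z W V (h | h) (h' | h')
        · exact Or.inl (by rw [h', h])
        · exact Or.inr (by rw [h', h])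
        · exact Or.inr (by rw [h', h])
        · exact Or.inl (by rw [h', h, bang_bang]) }

/-- The set `Ē_N⁺` of orbits on `E_N⁺`. -/
abbrev OrbPlus (N : ℕ) : Type := Quotient (orbitSetoid N (EPlus N))

/-- The set `Ē_N⁻` of orbits on `E_N⁻`. -/
abbrev OrbMinus (N : ℕ) : Type := Quotient (orbitSetoid N (EMinus N))

theorem gamma_eq_sum (Z : Finset ℕ) : gamma Z = ∑ x ∈ Z, (-1 : ℤ) ^ x := by
  unfold gamma
  rw [← Finset.sum_filter_add_sum_filter_not Z (fun x => Even x)]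
  have h1 : ∑ x ∈ Z.filter (fun x => Even x), (-1 : ℤ) ^ x
      = #(Z.filter fun x => Even x) := by
    rw [Finset.sum_congr rfl (fun x hx => Even.neg_one_pow (mem_filter.1 hx).2)]
    simp
  have h2 : ∑ x ∈ Z.filter (fun x => ¬ Even x), (-1 : ℤ) ^ x
      = -#(Z.filter fun x => Odd x) := by
    simp only [Nat.not_even_iff_odd]
    rw [Finset.sum_congr rfl (fun x hx => Odd.neg_one_pow (mem_filter.1 hx).2)]
    simp
  rw [h1, h2]; ring

theorem sum_Icc_even (m : ℕ) : ∑ x ∈ Icc 1 (2 * m), (-1 : ℤ) ^ x = 0 := by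
  induction m with
  | zero => simp
  | succ m ih =>
    rw [show 2 * (m + 1) = 2 * m + 1 + 1 by ring, Finset.sum_Icc_succ_top (by omega),
      Finset.sum_Icc_succ_top (by omega), ih]
    simp [pow_succ, pow_mul]

theorem even_gamma {Z : Finset ℕ} (h : Even #Z) : Even (gamma Z) := by
  have h2 : #(Z.filter fun x => Even x) + #(Z.filter fun x => Odd x) = #Z := by
    have := Finset.card_filter_add_card_filter_not (s := Z) (fun x => Even x)
    simpa only [Nat.not_even_iff_odd] using this
  unfold gamma
  obtain ⟨k, hk⟩ := h
  exact ⟨k - #(Z.filter fun x => Odd x), by omega⟩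

theorem bang_plus {N : ℕ} (hN : Odd N) {Z : Finset ℕ} (hZ : Z ∈ EPlus N) :
    bang N Z ∈ EPlus N ∧ gamma (bang N Z) = - gamma Z ∧
      ∀ x ∈ Icc 1 (N - 1), (x ∈ bang N Z ↔ x ∉ Z) := by
  obtain ⟨m, rfl⟩ := hN
  obtain ⟨h1, h2, h3⟩ := hZ
  have hs : Z ⊆ Icc 1 (2 * m) := by
    intro x hx
    have := mem_Icc.1 (h1 hx)
    have : x ≠ 2 * m + 1 := fun h => h3 (h ▸ hx)
    rw [mem_Icc]; omega
  have hb : bang (2 * m + 1) Z = Icc 1 (2 * m) \ Z := by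
    ext x; have := @hs x
    simp only [bang, mem_symmDiff, mem_sdiff, Nat.add_sub_cancel]; tauto
  rw [hb]
  refine ⟨⟨?_, ?_, ?_⟩, ?_, ?_⟩
  · intro x hx
    have := mem_Icc.1 (mem_sdiff.1 hx).1
    rw [mem_Icc]; omega
  · rw [card_sdiff_of_subset hs, Nat.card_Icc]
    have := card_le_card hs
    rw [Nat.card_Icc] at this
    rw [Nat.even_sub this]; simp [h2]
  · simp
  · have := Finset.sum_sdiff (f := fun x => (-1 : ℤ) ^ x) hs
    rw [sum_Icc_even] at this
    rw [gamma_eq_sum, gamma_eq_sum]; linarith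
  · intro x hx
    rw [Nat.add_sub_cancel] at hx
    simp only [mem_sdiff, hx, true_and]

theorem bang_minus {N : ℕ} (hN : Odd N) {Z : Finset ℕ} (hZ : Z ∈ EMinus N) :
    bang N Z ∈ EMinus N ∧ gamma (bang N Z) = - gamma Z - 2 := by
  obtain ⟨m, rfl⟩ := hN
  obtain ⟨h1, h2, h3⟩ := hZ
  have hs : Z.erase (2 * m + 1) ⊆ Icc 1 (2 * m) := by
    intro x hx
    rw [mem_erase] at hx
    have := mem_Icc.1 (h1 hx.2)
    rw [mem_Icc]; omega
  have hb : bang (2 * m + 1) Z = insert (2 * m + 1) (Icc 1 (2 * m) \ Z.erase (2 * m + 1)) := by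
    ext x; have := @hs x
    simp only [bang, mem_symmDiff, mem_sdiff, Nat.add_sub_cancel, mem_insert, mem_erase,
      mem_Icc] at this ⊢
    by_cases hx : x = 2 * m + 1
    · subst hx; simp [h3]
    · simp only [hx]; tauto
  have hn : 2 * m + 1 ∉ Icc 1 (2 * m) \ Z.erase (2 * m + 1) := by simp
  have hc := card_erase_add_one h3
  rw [hb]
  refine ⟨⟨?_, ?_, ?_⟩, ?_⟩
  · intro x hx
    rw [mem_insert, mem_sdiff, mem_Icc] at hx
    rw [mem_Icc]; omega
  · rw [card_insert_of_notMem hn, card_sdiff_of_subset hs, Nat.card_Icc]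
    have := card_le_card hs
    rw [Nat.card_Icc] at this
    rw [Nat.even_iff] at h2 ⊢
    omega
  · simp
  · have h4 := Finset.sum_sdiff (f := fun x => (-1 : ℤ) ^ x) hs
    have h5 := Finset.add_sum_erase Z (fun x => (-1 : ℤ) ^ x) h3
    have h6 : (-1 : ℤ) ^ (2 * m + 1) = -1 := Odd.neg_one_pow ⟨m, rfl⟩
    rw [sum_Icc_even] at h4
    rw [gamma_eq_sum, gamma_eq_sum, Finset.sum_insert hn]
    simp only [h6] at h5 ⊢
    linarith

/-- Each orbit on `E_N⁺` has exactly one element in `'E_N⁺`. -/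
theorem existsUnique_rep_plus {N : ℕ} (hN : Odd N) (h3 : 3 ≤ N) (Y : OrbPlus N) :
    ∃! Z : EPlus N, Z.1 ∈ EPlus' N ∧ (Quotient.mk _ Z : OrbPlus N) = Y := by
  induction Y using Quotient.inductionOn with
  | h W =>
  obtain ⟨hb1, hb2, hb3⟩ := bang_plus hN W.2
  have hb3 := hb3 (N - 1) (by rw [mem_Icc]; omega)
  have hor : ∀ Z : EPlus N, (Quotient.mk _ Z : OrbPlus N) = Quotient.mk _ W ↔
      (Z.1 = W.1 ∨ Z.1 = bang N W.1) := by
    intro Z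
    rw [eq_comm, Quotient.eq]; rfl
  by_cases h : W.1 ∈ EPlus' N
  · refine ⟨W, ⟨h, rfl⟩, ?_⟩
    rintro Z ⟨hZ, hZW⟩
    rcases (hor Z).1 hZW with e | e
    · exact Subtype.ext e
    · exfalso
      obtain ⟨-, h⟩ := h
      obtain ⟨-, hZ⟩ := hZ
      rw [e, hb2, hb3] at hZ
      rcases h with h | h <;> rcases hZ with hZ | hZ <;> first | omega | exact hZ.2 h.2
  · refine ⟨⟨bang N W.1, hb1⟩, ⟨⟨hb1, ?_⟩, (hor _).2 (Or.inr rfl)⟩, ?_⟩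
    · have h' : ¬ (gamma W.1 < 0 ∨ (gamma W.1 = 0 ∧ N - 1 ∉ W.1)) := fun hh => h ⟨W.2, hh⟩
      show gamma (bang N W.1) < 0 ∨ (gamma (bang N W.1) = 0 ∧ N - 1 ∉ bang N W.1)
      rw [hb2, hb3]
      rw [not_or, not_and] at h'
      obtain ⟨ha, hc⟩ := h'
      rcases eq_or_ne (gamma W.1) 0 with h0 | h0
      · exact Or.inr ⟨by omega, hc h0⟩
      · left; omega
    · rintro Z ⟨hZ, hZW⟩
      rcases (hor Z).1 hZW with e | e
      · exact absurd (e ▸ hZ) h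
      · exact Subtype.ext e

/-- Each orbit on `E_N⁻` has exactly one element in `'E_N⁻`. -/
theorem existsUnique_rep_minus {N : ℕ} (hN : Odd N) (Y : OrbMinus N) :
    ∃! Z : EMinus N, Z.1 ∈ EMinus' N ∧ (Quotient.mk _ Z : OrbMinus N) = Y := by
  induction Y using Quotient.inductionOn with
  | h W =>
  obtain ⟨hb1, hb2⟩ := bang_minus hN W.2
  obtain ⟨k, hk⟩ := even_gamma W.2.2.1
  have hor : ∀ Z : EMinus N, (Quotient.mk _ Z : OrbMinus N) = Quotient.mk _ W ↔
      (Z.1 = W.1 ∨ Z.1 = bang N W.1) := by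
    intro Z
    rw [eq_comm, Quotient.eq]; rfl
  by_cases h : 0 ≤ gamma W.1
  · refine ⟨W, ⟨⟨W.2, h⟩, rfl⟩, ?_⟩
    rintro Z ⟨⟨-, hZ⟩, hZW⟩
    rcases (hor Z).1 hZW with e | e
    · exact Subtype.ext e
    · rw [e, hb2] at hZ; omega
  · refine ⟨⟨bang N W.1, hb1⟩, ⟨⟨hb1, ?_⟩, (hor _).2 (Or.inr rfl)⟩, ?_⟩
    · show 0 ≤ gamma (bang N W.1)
      rw [hb2]; omega
    · rintro Z ⟨⟨-, hZ⟩, hZW⟩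
      rcases (hor Z).1 hZW with e | e
      · rw [e] at hZ; exact absurd hZ h
      · exact Subtype.ext e

/-- `Ỹ` for `Y ∈ Ē_N⁺`: the unique element of `Y` that lies in `'E_N⁺`. -/
noncomputable def repPlus {N : ℕ} (hN : Odd N) (h3 : 3 ≤ N) (Y : OrbPlus N) : Finset ℕ :=
  ((existsUnique_rep_plus hN h3 Y).choose : EPlus N).1

/-- `Ỹ` for `Y ∈ Ē_N⁻`: the unique element of `Y` that lies in `'E_N⁻`. -/
noncomputable def repMinus {N : ℕ} (hN : Odd N) (Y : OrbMinus N) : Finset ℕ :=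
  ((existsUnique_rep_minus hN Y).choose : EMinus N).1

/-- The relation `⪯̄` on `Ē_N⁺`; `barLEPlus hN h3 Y' Y` means `Y' ⪯̄ Y`. -/
def barLEPlus {N : ℕ} (hN : Odd N) (h3 : 3 ≤ N) : OrbPlus N → OrbPlus N → Prop :=
  Relation.ReflTransGen fun Y' Y =>
    leE N (repPlus hN h3 Y') (repPlus hN h3 Y) ∨
      |gamma (repPlus hN h3 Y')| < |gamma (repPlus hN h3 Y)|

/-- The relation `⪯̄` on `Ē_N⁻`; `barLEMinus hN Y' Y` means `Y' ⪯̄ Y`. -/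
def barLEMinus {N : ℕ} (hN : Odd N) : OrbMinus N → OrbMinus N → Prop :=
  Relation.ReflTransGen fun Y' Y =>
    leE N (repMinus hN Y') (repMinus hN Y) ∨
      |gamma (repMinus hN Y') + 1| < |gamma (repMinus hN Y) + 1|

end OrthBasis

namespace OrthBasis

open Finset
open scoped symmDiff

/-! Attach to `Z` the walk on the circle `ℤ/N` whose step at `x` is `(-1)^x`, reversed when `x ∈ Z`,
with heights normalized to change sign after one turn (`height`). The absolute heights are the
monotone invariants behind the theorem. For sets of even cardinality they determine `Z`: heights are
odd and their residue modulo 4 depends only on the position, which fixes the sign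
(`eq_of_abs_height_eq`).

They increase weakly along `⪯` (`abs_height_le_of_leE`). Let `M` be a matching in which every point
of an arc is an end of an arc, and let `c` arcs cross the edge from `y` to `y + 1`. The sum of the
arcs has height `±(1 + 2c)` there (`height_setSum`). In a union of members of `M`, each crossing
pair contributes `±2`, every other pair contributes `0`, and the points outside the support
contribute at most `1` in absolute value, so the height is bounded by `1 + 2c` (`abs_height_le`).
Each `B ∈ 𝒳` has such a matching with arc sum `'ε(B)`: `B` itself, or `B` with the pair `{u_B, N}`
added (`exists_full_matching`).

The height at `0` is `1 + 2γ`, so on the chosen representatives a step of `⪯` never decreases the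
numerical function of `γ` used in `⪯̄`. Along a cycle that function is constant, hence all absolute
heights are constant as well, and the cycle is trivial (`isPartialOrder_of_leE`). -/

/-! ### Sums and spans of sets. -/

theorem mem_setSum {ι : Type} [DecidableEq ι] (s : Finset ι) (f : ι → Finset ℕ) (x : ℕ) :
    x ∈ setSum s f ↔ Odd #(s.filter fun p => x ∈ f p) := by
  induction s using Finset.induction_on with
  | empty => simp [setSum]
  | insert a s ha ih =>
    have h : setSum (insert a s) f = f a ∆ setSum s f := Finset.fold_insert ha
    rw [h, mem_symmDiff, ih, filter_insert]
    split_ifs with hx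
    · rw [card_insert_of_notMem (by simp [ha]), Nat.odd_add_one]
      tauto
    · tauto

theorem mem_supp {B : Finset (ℕ × ℕ)} {x : ℕ} : x ∈ supp B ↔ ∃ p ∈ B, x = p.1 ∨ x = p.2 := by
  simp [supp]

theorem vec_apply (Z : Finset ℕ) (x : ℕ) : vec Z x = if x ∈ Z then 1 else 0 := by
  simp [vec, Set.indicator_apply]

/-- The elements of `⟨B⟩` are unions of members of `B`. -/
theorem subset_supp_of_mem_spanB {B : Finset (ℕ × ℕ)} (hB : ∀ p ∈ B, ∀ q ∈ B, p ≠ q →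
      Disjoint ({p.1, p.2} : Finset ℕ) {q.1, q.2}) {Z : Finset ℕ} (h : vec Z ∈ spanB B) :
    Z ⊆ supp B ∧ ∀ p ∈ B, (p.1 ∈ Z ↔ p.2 ∈ Z) := by
  have key : ∀ v ∈ spanB B, (∀ x, x ∉ supp B → v x = 0) ∧ ∀ p ∈ B, v p.1 = v p.2 := by
    intro v hv
    unfold spanB at hv
    induction hv using Submodule.span_induction with
    | mem v hv =>
      obtain ⟨q, hq, rfl⟩ := hv
      refine ⟨fun x hx => ?_, fun p hp => ?_⟩
      · simp only [vec, Set.indicator_apply_eq_zero]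
        intro hx'
        exact absurd (mem_supp.2 ⟨q, hq, by simpa using hx'⟩) hx
      · by_cases hpq : p = q
        · subst hpq; simp [vec]
        · have := hB p hp q hq hpq
          have h1 : p.1 ∉ ({q.1, q.2} : Finset ℕ) :=
            fun h => Finset.disjoint_left.1 this (by simp) h
          have h2 : p.2 ∉ ({q.1, q.2} : Finset ℕ) :=
            fun h => Finset.disjoint_left.1 this (by simp) h
          simp only [vec_apply, if_neg h1, if_neg h2]
    | zero => simp
    | add v w _ _ hv hw =>
      refine ⟨fun x hx => ?_, fun p hp => ?_⟩
      · simp [hv.1 x hx, hw.1 x hx]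
      · simp [hv.2 p hp, hw.2 p hp]
    | smul c v _ hv =>
      refine ⟨fun x hx => ?_, fun p hp => ?_⟩
      · simp [hv.1 x hx]
      · simp [hv.2 p hp]
  replace key := key _ h
  refine ⟨fun x hx => ?_, fun p hp => ?_⟩
  · by_contra hn
    have := key.1 x hn
    simp [vec_apply, hx] at this
  · have := key.2 p hp
    rw [vec_apply, vec_apply] at this
    split_ifs at this <;> simp_all

/-! ### Heights of the walk attached to a set. -/

/-- The sign `(-1)^x`, reversed on `Z`. -/
def sg (Z : Finset ℕ) (x : ℕ) : ℤ := (-1) ^ x * if x ∈ Z then -1 else 1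

/-- Twice the height at `y` of the walk on the circle `ℤ/N` with steps `sg Z`, normalized so that
it changes sign after one turn. -/
def height (N : ℕ) (Z : Finset ℕ) (y : ℕ) : ℤ :=
  ∑ x ∈ Icc 1 N, sg Z x * if x ≤ y then 1 else -1

theorem height_last (N : ℕ) (Z : Finset ℕ) : height N Z N = -height N Z 0 := by
  unfold height
  rw [← sum_neg_distrib]
  refine sum_congr rfl fun x hx => ?_
  rw [mem_Icc] at hx
  rw [if_pos hx.2, if_neg (by omega)]; ring

theorem height_succ {N : ℕ} (Z : Finset ℕ) {y : ℕ} (hy : y < N) :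
    height N Z (y + 1) = height N Z y + 2 * sg Z (y + 1) := by
  unfold height
  have : 2 * sg Z (y + 1) = ∑ x ∈ Icc 1 N, if x = y + 1 then 2 * sg Z x else 0 := by
    rw [sum_ite_eq' (Icc 1 N) (y + 1), if_pos (mem_Icc.2 ⟨by omega, by omega⟩)]
  rw [this, ← sum_add_distrib]
  refine sum_congr rfl fun x _ => ?_
  split_ifs <;> omega

/-- Links the walk with `γ`: for odd `N` the unreversed signs on `[1, N]` sum to `-1`, and reversing
those on `Z` changes the sum by `-2γ(Z)`; at `0` all weights are `-1`. -/
theorem height_zero {N : ℕ} (hN : Odd N) {Z : Finset ℕ} (hZ : Z ⊆ Icc 1 N) :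
    height N Z 0 = 1 + 2 * gamma Z := by
  obtain ⟨m, rfl⟩ := hN
  have h1 : ∑ x ∈ Icc 1 (2 * m + 1), (-1 : ℤ) ^ x = -1 := by
    rw [Finset.sum_Icc_succ_top (by omega), sum_Icc_even]
    simp [pow_succ, pow_mul]
  have h2 : ∑ x ∈ Icc 1 (2 * m + 1), (if x ∈ Z then (-1 : ℤ) ^ x else 0) = gamma Z := by
    rw [gamma_eq_sum, ← sum_filter, filter_mem_eq_inter, inter_eq_right.2 hZ]
  have h3 : height (2 * m + 1) Z 0 = ∑ x ∈ Icc 1 (2 * m + 1),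
      (-(-1 : ℤ) ^ x + 2 * if x ∈ Z then (-1 : ℤ) ^ x else 0) := by
    refine sum_congr rfl fun x hx => ?_
    rw [mem_Icc] at hx
    rw [if_neg (by omega), sg]
    split_ifs <;> ring
  rw [h3, sum_add_distrib, ← mul_sum, h2, sum_neg_distrib, h1]; ring

theorem sg_sq (Z : Finset ℕ) (x : ℕ) : sg Z x = 1 ∨ sg Z x = -1 := by
  unfold sg
  rcases neg_one_pow_eq_or ℤ x with h | h <;> rw [h] <;> split_ifs <;> simp

/-- The heights of a set of even cardinality are known modulo `4`. -/
theorem height_emod {N : ℕ} (hN : Odd N) {Z : Finset ℕ} (hZ : Z ⊆ Icc 1 N) (hc : Even #Z) {y : ℕ}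
    (hy : y ≤ N) : height N Z y % 4 = (1 + 2 * y) % 4 := by
  induction y with
  | zero =>
    obtain ⟨k, hk⟩ := even_gamma hc
    rw [height_zero hN hZ, hk]; push_cast; omega
  | succ y ih =>
    have := ih (by omega)
    rw [height_succ Z (by omega)]
    rcases sg_sq Z (y + 1) with h | h <;> rw [h] <;> push_cast <;> omega

/-- A set of even cardinality is determined by the absolute values of its heights. -/
theorem eq_of_abs_height_eq {N : ℕ} (hN : Odd N) {Z W : Finset ℕ} (hZ : Z ⊆ Icc 1 N)
    (hW : W ⊆ Icc 1 N) (hZc : Even #Z) (hWc : Even #W)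
    (h : ∀ y ≤ N, |height N Z y| = |height N W y|) : Z = W := by
  have heq : ∀ y ≤ N, height N Z y = height N W y := by
    intro y hy
    have h1 := height_emod hN hZ hZc hy
    have h2 := height_emod hN hW hWc hy
    -- Both heights are odd and congruent modulo 4, so they cannot be opposite.
    rcases abs_eq_abs.1 (h y hy) with h3 | h3 <;> omega
  have hmem : ∀ x ∈ Icc 1 N, (x ∈ Z ↔ x ∈ W) := by
    intro x hx
    rw [mem_Icc] at hx
    obtain ⟨y, rfl⟩ : ∃ y, x = y + 1 := ⟨x - 1, by omega⟩
    have h1 := height_succ Z (show y < N by omega)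
    have h2 := height_succ W (show y < N by omega)
    rw [heq _ hx.2, heq y (by omega)] at h1
    have h3 : sg Z (y + 1) = sg W (y + 1) := by linarith
    unfold sg at h3
    rcases neg_one_pow_eq_or ℤ (y + 1) with h | h <;> rw [h] at h3 <;> split_ifs at h3 <;> simp_all
  ext x
  exact ⟨fun hx => (hmem x (hZ hx)).1 hx, fun hx => (hmem x (hW hx)).2 hx⟩

theorem height_empty {N : ℕ} (hN : Odd N) {y : ℕ} (hy : y ≤ N) : height N ∅ y = (-1) ^ y := by
  induction y with
  | zero => rw [height_zero hN (by simp)]; simp [gamma]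
  | succ y ih => rw [height_succ _ (by omega), ih (by omega)]; simp [sg]; ring

/-! ### Arcs, crossings and the heights of a sum of arcs. -/

/-- The pair `p`, seen as an arc with an even number of elements on the circle `ℤ/N`, contains both
`y` and `y + 1`. -/
def Crosses (p : ℕ × ℕ) (y : ℕ) : Prop := Odd (p.2 - p.1) ↔ (p.1 ≤ y ∧ y < p.2)

open Classical in
/-- The number of arcs of `B` that contain both `y` and `y + 1`. -/
noncomputable def numCross (B : Finset (ℕ × ℕ)) (y : ℕ) : ℕ := #(B.filter fun p => Crosses p y)

/-- Every point of the arcs of `B` is an end of an arc of `B`. -/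
def Full (N : ℕ) (B : Finset (ℕ × ℕ)) : Prop := ∀ p ∈ B, bracket N p ⊆ supp B

/-- A point lies on an arc exactly when one of its two adjacent edges does. `Crosses p y` concerns
the edge from `y` to `y + 1`; the values `y = 0` and `y = N` both stand for the edge joining `N` to
`1`. -/
theorem mem_bracket_iff {N : ℕ} {p : ℕ × ℕ} (hp : 1 ≤ p.1 ∧ p.1 < p.2 ∧ p.2 ≤ N) {y : ℕ}
    (hy : y < N) : y + 1 ∈ bracket N p ↔ (Crosses p y ∨ Crosses p (y + 1)) := by
  unfold bracket Crosses
  split_ifs with h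
  · simp only [h, true_iff, mem_Icc]; omega
  · simp only [h, false_iff, mem_union, mem_Icc]; omega

theorem crosses_succ {p : ℕ × ℕ} {y : ℕ} (h1 : y + 1 ≠ p.1) (h2 : y + 1 ≠ p.2) :
    Crosses p (y + 1) ↔ Crosses p y := by
  unfold Crosses
  have : (p.1 ≤ y + 1 ∧ y + 1 < p.2) ↔ (p.1 ≤ y ∧ y < p.2) := by omega
  rw [this]

theorem crosses_succ_end {p : ℕ × ℕ} (hp : p.1 < p.2) {y : ℕ} (h : y + 1 = p.1 ∨ y + 1 = p.2) :
    Crosses p (y + 1) ↔ ¬ Crosses p y := by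
  unfold Crosses
  have : (p.1 ≤ y + 1 ∧ y + 1 < p.2) ↔ ¬ (p.1 ≤ y ∧ y < p.2) := by omega
  rw [this]; tauto

theorem numCross_last {N : ℕ} {B : Finset (ℕ × ℕ)} (hB : B ∈ P N) :
    numCross B N = numCross B 0 := by
  classical
  unfold numCross
  congr 1
  refine filter_congr fun p hp => ?_
  have := hB.1 p hp
  unfold Crosses
  have h1 : (p.1 ≤ N ∧ N < p.2) ↔ (p.1 ≤ 0 ∧ 0 < p.2) := by omega
  rw [h1]

theorem numCross_eq_zero {N : ℕ} {B : Finset (ℕ × ℕ)} (hB : B ∈ P N) (hF : Full N B) {y : ℕ}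
    (hy : y < N) (h : y + 1 ∉ supp B) :
    numCross B y = 0 ∧ numCross B (y + 1) = 0 ∧ y + 1 ∉ setSum B (bracket N) := by
  classical
  have h1 : ∀ p ∈ B, y + 1 ∉ bracket N p := fun p hp hy => h (hF p hp hy)
  have h2 : ∀ p ∈ B, ¬ (Crosses p y ∨ Crosses p (y + 1)) := fun p hp =>
    (mem_bracket_iff (hB.1 p hp) hy).not.1 (h1 p hp)
  refine ⟨?_, ?_, ?_⟩
  · rw [numCross, card_eq_zero, filter_eq_empty_iff]
    exact fun p hp hc => h2 p hp (Or.inl hc)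
  · rw [numCross, card_eq_zero, filter_eq_empty_iff]
    exact fun p hp hc => h2 p hp (Or.inr hc)
  · rw [mem_setSum, filter_eq_empty_iff.2 fun p hp => h1 p hp]; simp

theorem end_ne {N : ℕ} {B : Finset (ℕ × ℕ)} (hB : B ∈ P N) {p q : ℕ × ℕ} (hp : p ∈ B) (hq : q ∈ B)
    (hne : p ≠ q) {x : ℕ} (hx : x = p.1 ∨ x = p.2) : x ≠ q.1 ∧ x ≠ q.2 := by
  have h := Finset.disjoint_left.1 (hB.2 p hp q hq hne) (show x ∈ _ by simpa using hx)
  simpa using h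

/-- At an end of `q` only the crossing status of `q` changes, since pairs are disjoint. The witness
`d` counts the other arcs through that point, so `d + 1` arcs contain it in all. -/
theorem numCross_of_mem_supp {N : ℕ} {B : Finset (ℕ × ℕ)} (hB : B ∈ P N) {y : ℕ}
    (hy : y < N) (h : y + 1 ∈ supp B) :
    ∃ d, ((numCross B y = d ∧ numCross B (y + 1) = d + 1) ∨
      (numCross B y = d + 1 ∧ numCross B (y + 1) = d)) ∧
      (y + 1 ∈ setSum B (bracket N) ↔ Odd (d + 1)) := by
  classical
  obtain ⟨q, hq, hyq⟩ := mem_supp.1 h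
  have hqN := hB.1 q hq
  have hne : ∀ p ∈ B.erase q, Crosses p (y + 1) ↔ Crosses p y := fun p hp =>
    have := end_ne hB hq (mem_of_mem_erase hp) (ne_of_mem_erase hp).symm hyq
    crosses_succ this.1 this.2
  have hcard : ∀ (R : ℕ × ℕ → Prop) [DecidablePred R], #(B.filter R)
      = #((B.erase q).filter R) + if R q then 1 else 0 := by
    intro R _
    conv_lhs => rw [← insert_erase hq, filter_insert]
    split_ifs
    · rw [card_insert_of_notMem (by simp)]
    · simp
  have e1 : (B.erase q).filter (fun p => Crosses p (y + 1))
      = (B.erase q).filter fun p => Crosses p y := filter_congr hne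
  have e2 : (B.erase q).filter (fun p => y + 1 ∈ bracket N p)
      = (B.erase q).filter fun p => Crosses p y := filter_congr fun p hp => by
    rw [mem_bracket_iff (hB.1 p (mem_of_mem_erase hp)) hy, hne p hp, or_self]
  have hend := crosses_succ_end hqN.2.1 hyq
  have hbr : y + 1 ∈ bracket N q := by
    rw [mem_bracket_iff hqN hy, hend]; tauto
  refine ⟨#((B.erase q).filter fun p => Crosses p y), ?_, ?_⟩
  · unfold numCross
    rw [hcard, hcard, e1]
    by_cases hc : Crosses q y <;> simp [hc, hend]
  · rw [mem_setSum, hcard, e2, if_pos hbr]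

/-- The heights of the sum of the arcs. -/
theorem height_setSum {N : ℕ} (hN : Odd N) {B : Finset (ℕ × ℕ)} (hB : B ∈ P N) (hF : Full N B)
    {y : ℕ} (hy : y ≤ N) :
    height N (setSum B (bracket N)) y = (-1) ^ (y + numCross B y) * (1 + 2 * numCross B y) := by
  set Z := setSum B (bracket N)
  set A : ℕ → ℤ := fun y => (-1) ^ (y + numCross B y) * (1 + 2 * numCross B y) with hA
  -- The claimed formula obeys the recursion of `height_succ`. At a point off the support no arc is
  -- present, and the value merely alternates between `1` and `-1`.
  have hstep : ∀ y < N, A (y + 1) = A y + 2 * sg Z (y + 1) := by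
    intro y hy
    by_cases h : y + 1 ∈ supp B
    · obtain ⟨d, hd, hZ⟩ := numCross_of_mem_supp hB hy h
      have hs : sg Z (y + 1) = (-1) ^ (y + d) := by
        unfold sg
        rw [if_congr hZ rfl rfl]
        rcases Nat.even_or_odd d with h | h
        · rw [if_pos h.add_one, pow_add _ y d, h.neg_one_pow]; ring
        · rw [if_neg (Nat.not_odd_iff_even.2 h.add_one), pow_add _ y d, h.neg_one_pow]; ring
      rcases hd with ⟨h1, h2⟩ | ⟨h1, h2⟩ <;> simp only [hA, h1, h2, hs] <;> push_cast <;> ring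
    · obtain ⟨h1, h2, h3⟩ := numCross_eq_zero hB hF hy h
      simp only [hA, h1, h2, sg, Z, if_neg h3]; push_cast; ring
  have hconst : ∀ y ≤ N, height N Z y - A y = height N Z 0 - A 0 := by
    intro y hy
    induction y with
    | zero => rfl
    | succ y ih => rw [height_succ Z (by omega), hstep y (by omega), ← ih (by omega)]; ring
  -- The two sides differ by a constant, and both change sign after one turn, so the constant is
  -- `0`.
  have hAN : A N = -A 0 := by
    simp only [hA, numCross_last hB, pow_add _ N, hN.neg_one_pow]; simp
  have h1 := hconst N le_rfl
  rw [height_last, hAN] at h1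
  have h2 := hconst y hy
  change height N Z y = A y
  linarith

/-! ### Bounding the heights of unions of members. -/

/-- The contribution of the points outside the support to the heights. -/
def outer (N : ℕ) (B : Finset (ℕ × ℕ)) (y : ℕ) : ℤ :=
  ∑ x ∈ Icc 1 N \ supp B, (-1) ^ x * if x ≤ y then 1 else -1

/-- The ends of a pair are both in `Z` or both outside, so their signs agree if the pair lies in
`B⁰` and are opposite if it lies in `B¹`. Combined with the weights at `y`, the pair contributes
`±2` if its arc crosses at `y`, and `0` otherwise. -/
theorem abs_height_sub_outer_le {N : ℕ} {B : Finset (ℕ × ℕ)} (hB : B ∈ P N) {Z : Finset ℕ}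
    (hZs : Z ⊆ supp B) (hZ : ∀ p ∈ B, (p.1 ∈ Z ↔ p.2 ∈ Z)) (y : ℕ) :
    |height N Z y - outer N B y| ≤ 2 * numCross B y := by
  classical
  have hsub : supp B ⊆ Icc 1 N := by
    intro x hx
    obtain ⟨p, hp, hx⟩ := mem_supp.1 hx
    have := hB.1 p hp
    rw [mem_Icc]; omega
  have h1 : height N Z y - outer N B y
      = ∑ x ∈ supp B, sg Z x * if x ≤ y then 1 else -1 := by
    unfold height outer
    rw [← sum_sdiff hsub, add_comm, add_sub_assoc, ← sum_sub_distrib]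
    refine add_eq_left.2 (sum_eq_zero fun x hx => ?_)
    rw [sg, if_neg fun h => (mem_sdiff.1 hx).2 (hZs h), mul_one, sub_self]
  have h2 : ∑ x ∈ supp B, (sg Z x * if x ≤ y then 1 else -1)
      = ∑ p ∈ B, ((sg Z p.1 * if p.1 ≤ y then 1 else -1)
        + (sg Z p.2 * if p.2 ≤ y then 1 else -1)) := by
    unfold supp
    rw [sum_biUnion fun p hp q hq hne => hB.2 p hp q hq hne]
    refine sum_congr rfl fun p hp => ?_
    rw [sum_pair (by have := hB.1 p hp; omega)]
  have h3 : (2 * numCross B y : ℤ) = ∑ p ∈ B, if Crosses p y then 2 else 0 := by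
    rw [numCross, ← sum_filter, sum_const]; simp [mul_comm]
  rw [h1, h2, h3]
  refine (abs_sum_le_sum_abs _ _).trans (sum_le_sum fun p hp => ?_)
  have hp' := hB.1 p hp
  obtain ⟨d, hd⟩ : ∃ d, p.2 = p.1 + d := ⟨p.2 - p.1, by omega⟩
  have hs : sg Z p.2 = (-1) ^ d * sg Z p.1 := by
    unfold sg
    rw [if_congr (hZ p hp) rfl rfl, hd, pow_add]; ring
  have ho : Crosses p y ↔ (Odd d ↔ (p.1 ≤ y ∧ y < p.2)) := by
    rw [Crosses, hd, Nat.add_sub_cancel_left]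
  rw [hs]
  simp only [ho]
  rcases Nat.even_or_odd d with h | h
  · rw [h.neg_one_pow]
    simp only [Nat.not_odd_iff_even.2 h, false_iff]
    rcases sg_sq Z p.1 with h | h <;> rw [h] <;> split_ifs <;> first | omega | norm_num
  · rw [h.neg_one_pow]
    simp only [h, true_iff]
    rcases sg_sq Z p.1 with h | h <;> rw [h] <;> split_ifs <;> first | omega | norm_num

/-- At a point off the support no arc crosses, so `outer` equals the height of the empty set there,
which is `±1`. It is constant across points of the support, so this bound propagates around the
circle. -/
theorem abs_outer_le_one {N : ℕ} (hN : Odd N) {B : Finset (ℕ × ℕ)} (hB : B ∈ P N)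
    (hF : Full N B) {y : ℕ} (hy : y ≤ N) : |outer N B y| ≤ 1 := by
  have hout : ∀ y < N, y + 1 ∉ supp B → |outer N B (y + 1)| ≤ 1 := by
    intro y hy h
    have h1 := abs_height_sub_outer_le hB (Z := ∅) (by simp) (by simp) (y + 1)
    rw [(numCross_eq_zero hB hF hy h).2.1, height_empty hN hy] at h1
    have h2 : (-1) ^ (y + 1) = outer N B (y + 1) := by
      have := abs_nonpos_iff.1 (show _ ≤ (0 : ℤ) by simpa using h1)
      linarith
    rw [← h2]; simp
  have hin : ∀ y < N, y + 1 ∈ supp B → outer N B (y + 1) = outer N B y := by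
    intro y hy h
    refine sum_congr rfl fun x hx => ?_
    have : x ≠ y + 1 := fun e => (mem_sdiff.1 hx).2 (e ▸ h)
    split_ifs <;> omega
  have hor : ∀ y ≤ N, outer N B y = outer N B 0 ∨ |outer N B y| ≤ 1 := by
    intro y hy
    induction y with
    | zero => exact Or.inl rfl
    | succ y ih =>
      by_cases h : y + 1 ∈ supp B
      · rw [hin y (by omega) h]; exact ih (by omega)
      · exact Or.inr (hout y (by omega) h)
  have hlast : outer N B N = -outer N B 0 := by
    unfold outer
    rw [← sum_neg_distrib]
    refine sum_congr rfl fun x hx => ?_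
    have := mem_Icc.1 (mem_sdiff.1 hx).1
    rw [if_pos this.2, if_neg (by omega)]; ring
  -- If the value at `0` persists up to `N`, the sign change after one turn forces it to vanish.
  have h0 : |outer N B 0| ≤ 1 := by
    rcases hor N le_rfl with h | h
    · have : outer N B 0 = 0 := by omega
      simp [this]
    · rwa [hlast, abs_neg] at h
  rcases hor y hy with h | h
  · rwa [h]
  · exact h

/-- Among the unions of members of `B`, the sum of the arcs has the largest heights. -/
theorem abs_height_le {N : ℕ} (hN : Odd N) {B : Finset (ℕ × ℕ)} (hB : B ∈ P N) (hF : Full N B)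
    {Z : Finset ℕ} (hZs : Z ⊆ supp B) (hZ : ∀ p ∈ B, (p.1 ∈ Z ↔ p.2 ∈ Z)) {y : ℕ} (hy : y ≤ N) :
    |height N Z y| ≤ |height N (setSum B (bracket N)) y| := by
  have h1 := abs_height_sub_outer_le hB hZs hZ y
  have h2 := abs_outer_le_one hN hB hF hy
  rw [height_setSum hN hB hF hy, abs_mul, abs_pow, abs_neg, abs_one, one_pow, one_mul,
    abs_of_nonneg (by positivity : (0 : ℤ) ≤ 1 + 2 * numCross B y)]
  have h3 := abs_sub_abs_le_abs_sub (height N Z y) (outer N B y)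
  linarith

/-! ### Covered intervals and nests. -/

theorem ZeroCovered.exists_tile {B : Finset (ℕ × ℕ)} {Y : Finset ℕ} (h : ZeroCovered B Y) {x : ℕ}
    (hx : x ∈ Y) : ∃ r ∈ part1 B, x ∈ Icc r.1 r.2 ∧ Icc r.1 r.2 ⊆ Y := by
  obtain ⟨T, hT, -, rfl⟩ := h
  obtain ⟨r, hr, hxr⟩ := mem_biUnion.1 hx
  exact ⟨r, hT hr, hxr, subset_biUnion_of_mem (fun p : ℕ × ℕ => Icc p.1 p.2) hr⟩

theorem ZeroCovered.even_card {B : Finset (ℕ × ℕ)} {Y : Finset ℕ} (h : ZeroCovered B Y) :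
    Even #Y := by
  obtain ⟨T, hT, hd, rfl⟩ := h
  rw [card_biUnion fun p hp q hq hne => hd hp hq hne]
  refine even_sum _ fun p hp => ?_
  obtain ⟨k, hk⟩ := (mem_filter.1 (hT hp)).2
  rw [Nat.card_Icc]
  exact ⟨k + 1, by omega⟩

/-- The intervals of the cover avoid `u`, so each lies on one side of it. Requiring `1 ≤ a` keeps `u
- 1` from being truncated at `u = 0`. -/
theorem OneCovered.exists_split {B : Finset (ℕ × ℕ)} {a b : ℕ} (ha : 1 ≤ a) (h : OneCovered B (Icc a b)) :
    ∃ u ∈ Icc a b, ZeroCovered B (Icc a (u - 1)) ∧ ZeroCovered B (Icc (u + 1) b) := by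
  obtain ⟨T, hT, hd, u, hu, h⟩ := h
  have hab : u ∈ Icc a b := h ▸ mem_insert_self _ _
  have hcov : ∀ x, x ∈ Icc a b ↔ x = u ∨ ∃ p ∈ T, x ∈ Icc p.1 p.2 := by
    intro x; rw [h, mem_insert, mem_biUnion]
  have hu' : ∀ p ∈ T, p.1 ≤ p.2 ∧ (p.2 < u ∨ u < p.1) := by
    intro p hp
    have h1 : u ∉ Icc p.1 p.2 := fun h' => hu (mem_biUnion.2 ⟨p, hp, h'⟩)
    obtain ⟨k, hk⟩ := (mem_filter.1 (hT hp)).2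
    rw [mem_Icc] at h1
    omega
  refine ⟨u, hab, ⟨T.filter fun p => p.2 < u, (filter_subset _ _).trans hT,
    hd.subset (coe_subset.2 (filter_subset _ _)), ?_⟩, ⟨T.filter fun p => u < p.1, (filter_subset _ _).trans hT,
    hd.subset (coe_subset.2 (filter_subset _ _)), ?_⟩⟩
  · ext x
    simp only [mem_biUnion, mem_filter, mem_Icc] at hcov hab ⊢
    constructor
    · intro hx
      rcases (hcov x).1 (by omega) with h1 | ⟨p, hp, hxp⟩
      · omega
      · exact ⟨p, ⟨hp, by have := hu' p hp; omega⟩, hxp⟩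
    · rintro ⟨p, ⟨hp, hpu⟩, hxp⟩
      have := (hcov x).2 (Or.inr ⟨p, hp, hxp⟩)
      omega
  · ext x
    simp only [mem_biUnion, mem_filter, mem_Icc] at hcov hab ⊢
    constructor
    · intro hx
      rcases (hcov x).1 (by omega) with h1 | ⟨p, hp, hxp⟩
      · omega
      · exact ⟨p, ⟨hp, by have := hu' p hp; omega⟩, hxp⟩
    · rintro ⟨p, ⟨hp, hpu⟩, hxp⟩
      have := (hcov x).2 (Or.inr ⟨p, hp, hxp⟩)
      omega

/-- An interval spanned by a member of `B¹` is a union of members of `B¹`. -/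
theorem tile_closed {N : ℕ} {B : Finset (ℕ × ℕ)} (hB : B ∈ PStar N) {q : ℕ × ℕ}
    (hq : q ∈ part1 B) : Icc q.1 q.2 ⊆ supp B ∧ ∀ p ∈ B, ∀ x ∈ Icc q.1 q.2,
      (x = p.1 ∨ x = p.2) → p ∈ part1 B ∧ q.1 ≤ p.1 ∧ p.2 ≤ q.2 := by
  obtain ⟨hP, h1, -⟩ := hB
  induction hn : q.2 - q.1 using Nat.strong_induction_on generalizing q with
  | _ n ih =>
  have hqB := (mem_filter.1 hq).1
  -- A point of the interval is an end of `q` or lies in a strictly shorter interval inside it, to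
  -- which the induction on length applies.
  have key : ∀ x ∈ Icc q.1 q.2, (x = q.1 ∨ x = q.2) ∨ ∃ r ∈ part1 B, x ∈ Icc r.1 r.2 ∧
      r.2 - r.1 < n ∧ q.1 ≤ r.1 ∧ r.2 ≤ q.2 := by
    intro x hx
    rw [mem_Icc] at hx
    by_cases hx' : x = q.1 ∨ x = q.2
    · exact Or.inl hx'
    · obtain ⟨r, hr, hxr, hsub⟩ := (h1 q hq).exists_tile (x := x) (by rw [mem_Icc]; omega)
      have hle := mem_Icc.1 hxr
      have ha := mem_Icc.1 (hsub (left_mem_Icc.2 (by omega)))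
      have hb := mem_Icc.1 (hsub (right_mem_Icc.2 (by omega)))
      exact Or.inr ⟨r, hr, hxr, by omega, by omega, by omega⟩
  refine ⟨fun x hx => ?_, fun p hp x hx hxp => ?_⟩
  · rcases key x hx with h | ⟨r, hr, hxr, hlt, -⟩
    · exact mem_supp.2 ⟨q, hqB, h⟩
    · exact (ih _ hlt hr rfl).1 hxr
  · rcases key x hx with h | ⟨r, hr, hxr, hlt, hle⟩
    · have : q = p := by
        by_contra hne
        have := end_ne hP hqB hp hne h
        tauto
      subst this
      exact ⟨hq, le_rfl, le_rfl⟩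
    · obtain ⟨h2, h3⟩ := (ih _ hlt hr rfl).2 p hp x hxr hxp
      exact ⟨h2, by omega, by omega⟩

theorem ZeroCovered.subset_supp {N : ℕ} {B : Finset (ℕ × ℕ)} (hB : B ∈ PStar N) {Y : Finset ℕ}
    (h : ZeroCovered B Y) : Y ⊆ supp B := fun x hx => by
  obtain ⟨r, hr, hxr, -⟩ := h.exists_tile hx
  exact (tile_closed hB hr).1 hxr

theorem ZeroCovered.mem_of_mem {N : ℕ} {B : Finset (ℕ × ℕ)} (hB : B ∈ PStar N) {Y : Finset ℕ}
    (h : ZeroCovered B Y) {p : ℕ × ℕ} (hp : p ∈ B) (hpY : p.1 ∈ Y ∨ p.2 ∈ Y) :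
    p.1 ∈ Y ∧ p.2 ∈ Y := by
  have key : ∀ x ∈ Y, (x = p.1 ∨ x = p.2) → p.1 ∈ Y ∧ p.2 ∈ Y := by
    intro x hx hxp
    obtain ⟨r, hr, hxr, hsub⟩ := h.exists_tile hx
    obtain ⟨-, h1, h2⟩ := (tile_closed hB hr).2 p hp x hxr hxp
    have := hB.1.1 p hp
    exact ⟨hsub (mem_Icc.2 ⟨by omega, by omega⟩), hsub (mem_Icc.2 ⟨by omega, by omega⟩)⟩
  rcases hpY with h | h
  · exact key _ h (Or.inl rfl)
  · exact key _ h (Or.inr rfl)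

theorem IsNest.mem_part0 {B : Finset (ℕ × ℕ)} {i : ℕ → ℕ} (h : IsNest B i) {k : ℕ} (h1 : 1 ≤ k)
    (h2 : k ≤ #(part0 B)) : (i k, i (2 * #(part0 B) + 1 - k)) ∈ part0 B := by
  have := mem_image_of_mem (fun k => (i k, i (2 * #(part0 B) + 1 - k))) (mem_Icc.2 ⟨h1, h2⟩)
  rwa [← h.2] at this

theorem IsNest.le_of_mem {B : Finset (ℕ × ℕ)} {i : ℕ → ℕ} (h : IsNest B i) {p : ℕ × ℕ}
    (hp : p ∈ part0 B) : i 1 ≤ p.1 ∧ p.2 ≤ i (2 * #(part0 B)) := by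
  rw [h.2] at hp
  obtain ⟨k, hk, rfl⟩ := mem_image.1 hp
  rw [mem_Icc] at hk
  exact ⟨h.1.monotoneOn ⟨by omega, by omega⟩ ⟨by omega, by omega⟩ hk.1,
    h.1.monotoneOn ⟨by omega, by omega⟩ ⟨by omega, by omega⟩ (by omega)⟩

theorem IsNest.outer_mem {B : Finset (ℕ × ℕ)} {i : ℕ → ℕ} (h : IsNest B i)
    (hs : #(part0 B) ≠ 0) : (i 1, i (2 * #(part0 B))) ∈ part0 B := by
  simpa using h.mem_part0 le_rfl (Nat.one_le_iff_ne_zero.2 hs)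

/-- Each outermost pair is enclosed by the other. This is needed because the covering conditions
each quantify over their own sequence. -/
theorem IsNest.outer_unique {B : Finset (ℕ × ℕ)} {i j : ℕ → ℕ} (hi : IsNest B i)
    (hj : IsNest B j) (hs : #(part0 B) ≠ 0) :
    i 1 = j 1 ∧ i (2 * #(part0 B)) = j (2 * #(part0 B)) := by
  have h1 := hi.le_of_mem (hj.outer_mem hs)
  have h2 := hj.le_of_mem (hi.outer_mem hs)
  exact ⟨le_antisymm h1.1 h2.1, le_antisymm h2.2 h1.2⟩

/-- If the points outside the outermost member of `B⁰` are covered, then so are the points outside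
any member of `B⁰`. -/
theorem outside_subset {N : ℕ} {B : Finset (ℕ × ℕ)} (hB : B ∈ PStar N) (hs : #(part0 B) ≠ 0)
    {j : ℕ → ℕ} (hj : IsNest B j) {S : Finset ℕ} (hS : supp B ⊆ S) (hl : Icc 1 (j 1 - 1) ⊆ S)
    (hr : Icc (j (2 * #(part0 B)) + 1) N ⊆ S) {p : ℕ × ℕ} (hp : p ∈ part0 B) :
    Icc p.2 N ∪ Icc 1 p.1 ⊆ S := by
  have hB' := hB
  obtain ⟨-, -, i, hi, hg1, hg2⟩ := hB'
  obtain ⟨e1, e2⟩ := hi.outer_unique hj hs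
  rw [← e1] at hl
  rw [← e2] at hr
  set s := #(part0 B)
  have hends : ∀ k, 1 ≤ k → k ≤ s → i k ∈ S ∧ i (2 * s + 1 - k) ∈ S := fun k h1 h2 => by
    have := (mem_filter.1 (hi.mem_part0 h1 h2)).1
    exact ⟨hS (mem_supp.2 ⟨_, this, Or.inl rfl⟩), hS (mem_supp.2 ⟨_, this, Or.inr rfl⟩)⟩
  -- Move inward from the outermost pair: each new stretch is a covered gap followed by an end of a
  -- member of `B⁰`.
  have hleft : ∀ k, 1 ≤ k → k ≤ s → Icc 1 (i k) ⊆ S := by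
    intro k h1 h2 x hx
    rw [mem_Icc] at hx
    induction k, h1 using Nat.le_induction with
    | base =>
      rcases eq_or_ne x (i 1) with h | h
      · exact h ▸ (hends 1 le_rfl h2).1
      · exact hl (mem_Icc.2 ⟨by omega, by omega⟩)
    | succ k h1 ih =>
      by_cases h : x ≤ i k
      · exact ih (by omega) ⟨hx.1, h⟩
      · rcases eq_or_ne x (i (k + 1)) with h' | h'
        · exact h' ▸ (hends (k + 1) (by omega) h2).1
        · exact hS ((hg1 k h1 (by omega)).subset_supp hB (mem_Icc.2 ⟨by omega, by omega⟩))
  have hright : ∀ k, 1 ≤ k → k ≤ s → Icc (i (2 * s + 1 - k)) N ⊆ S := by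
    intro k h1 h2 x hx
    rw [mem_Icc] at hx
    induction k, h1 using Nat.le_induction with
    | base =>
      have h3 := (hends 1 le_rfl h2).2
      rw [Nat.add_sub_cancel] at hx h3
      rcases eq_or_ne x (i (2 * s)) with h | h
      · exact h ▸ h3
      · exact hr (mem_Icc.2 ⟨by omega, by omega⟩)
    | succ k h1 ih =>
      by_cases h : i (2 * s + 1 - k) ≤ x
      · exact ih (by omega) ⟨h, hx.2⟩
      · rcases eq_or_ne x (i (2 * s + 1 - (k + 1))) with h' | h'
        · exact h' ▸ (hends (k + 1) (by omega) h2).2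
        · have := (hg2 (2 * s + 1 - (k + 1)) (by omega) (by omega)).subset_supp hB
          rw [show 2 * s + 1 - (k + 1) + 1 = 2 * s + 1 - k by omega] at this
          exact hS (this (mem_Icc.2 ⟨by omega, by omega⟩))
  rw [hi.2] at hp
  obtain ⟨k, hk, rfl⟩ := mem_image.1 hp
  rw [mem_Icc] at hk
  exact union_subset (hright k hk.1 hk.2) (hleft k hk.1 hk.2)

/-! ### Full matchings attached to the elements of `𝒳`. -/

theorem part0_or_part1 {B : Finset (ℕ × ℕ)} {p : ℕ × ℕ} (hp : p ∈ B) :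
    p ∈ part0 B ∨ p ∈ part1 B := by
  rcases Nat.even_or_odd (p.2 - p.1) with h | h
  · exact Or.inl (mem_filter.2 ⟨hp, h⟩)
  · exact Or.inr (mem_filter.2 ⟨hp, h⟩)

/-- `S` is kept general so that it can be the support of `B` or of `B` enlarged by `{u_B, N}`. -/
theorem bracket_subset {N : ℕ} {B : Finset (ℕ × ℕ)} (hB : B ∈ PStar N) {S : Finset ℕ}
    (hS : supp B ⊆ S) (h0 : ∀ p ∈ part0 B, Icc p.2 N ∪ Icc 1 p.1 ⊆ S) {p : ℕ × ℕ} (hp : p ∈ B) :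
    bracket N p ⊆ S := by
  unfold bracket
  split_ifs with h
  · exact ((tile_closed hB (mem_filter.2 ⟨hp, h⟩)).1).trans hS
  · exact h0 p (mem_filter.2 ⟨hp, Nat.not_odd_iff_even.1 h⟩)

theorem full_of_condI {N : ℕ} {B : Finset (ℕ × ℕ)} (hB : B ∈ PStar N) (h : CondI N B) :
    Full N B := by
  intro p hp
  refine bracket_subset hB subset_rfl (fun q hq => ?_) hp
  have hs : #(part0 B) ≠ 0 := card_ne_zero_of_mem hq
  rcases h with h | ⟨i, hi, hl, hr⟩
  · exact absurd h hs
  · exact outside_subset hB hs hi subset_rfl (hl.subset_supp hB) (hr.subset_supp hB) hq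

/-- An infimum in `ℕ` is attained once the set is nonempty, and `OneCovered.exists_split` supplies
an element. -/
theorem uB_spec {N : ℕ} {B : Finset (ℕ × ℕ)} (h : ∃ i, IsNest B i ∧
      (CondIIi N B i ∨ CondIIii N B i)) : ∃ i, IsNest B i ∧
    ((CondIIi N B i ∧ uB N B ∈ Icc 1 (i 1 - 1) ∧
        ZeroCovered B (Icc 1 (uB N B - 1)) ∧ ZeroCovered B (Icc (uB N B + 1) (i 1 - 1))) ∨
      (CondIIii N B i ∧ uB N B ∈ Icc (i (2 * #(part0 B)) + 1) (N - 1) ∧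
        ZeroCovered B (Icc (i (2 * #(part0 B)) + 1) (uB N B - 1)) ∧
        ZeroCovered B (Icc (uB N B + 1) (N - 1)))) := by
  refine Nat.sInf_mem (s := {u | ∃ i, IsNest B i ∧
    ((CondIIi N B i ∧ u ∈ Icc 1 (i 1 - 1) ∧
        ZeroCovered B (Icc 1 (u - 1)) ∧ ZeroCovered B (Icc (u + 1) (i 1 - 1))) ∨
      (CondIIii N B i ∧ u ∈ Icc (i (2 * #(part0 B)) + 1) (N - 1) ∧
        ZeroCovered B (Icc (i (2 * #(part0 B)) + 1) (u - 1)) ∧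
        ZeroCovered B (Icc (u + 1) (N - 1))))}) ?_
  obtain ⟨i, hi, h | h⟩ := h
  · obtain ⟨u, hu⟩ := h.1.exists_split le_rfl
    exact ⟨u, i, hi, Or.inl ⟨h, hu⟩⟩
  · obtain ⟨u, hu⟩ := h.2.exists_split (by omega)
    exact ⟨u, i, hi, Or.inr ⟨h, hu⟩⟩

theorem supp_insert (p : ℕ × ℕ) (B : Finset (ℕ × ℕ)) :
    supp (insert p B) = {p.1, p.2} ∪ supp B := biUnion_insert

theorem insert_mem_P {N : ℕ} {B : Finset (ℕ × ℕ)} (hB : B ∈ P N) {p : ℕ × ℕ} (h1 : 1 ≤ p.1)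
    (h2 : p.1 < p.2) (h3 : p.2 ≤ N) (h4 : p.1 ∉ supp B) (h5 : p.2 ∉ supp B) :
    insert p B ∈ P N := by
  have key : ∀ q ∈ B, Disjoint ({p.1, p.2} : Finset ℕ) {q.1, q.2} := by
    intro q hq
    rw [Finset.disjoint_left]
    intro x hx hxq
    have : x ∈ supp B := mem_supp.2 ⟨q, hq, by simpa using hxq⟩
    rcases (by simpa using hx : x = p.1 ∨ x = p.2) with rfl | rfl
    · exact h4 this
    · exact h5 this
  refine ⟨fun q hq => ?_, fun q hq r hr hne => ?_⟩
  · rcases mem_insert.1 hq with rfl | hq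
    · exact ⟨h1, h2, h3⟩
    · exact hB.1 q hq
  · rcases mem_insert.1 hq with hq' | hq' <;> rcases mem_insert.1 hr with hr' | hr'
    · exact absurd (hq'.trans hr'.symm) hne
    · exact hq' ▸ key r hr'
    · exact hr' ▸ (key q hq').symm
    · exact hB.2 q hq' r hr' hne

/-- For `B ∈ 𝒳⁺` with `|B⁰|` odd, adding the pair `{u_B, N}` gives a matching all of whose arcs are
covered, and `c_B` is the arc of `{u_B, N}`. -/
theorem insert_uB {N : ℕ} (hN : Odd N) {B : Finset (ℕ × ℕ)} (hB : B ∈ PStar N)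
    (hNB : N ∉ supp B) (hs : #(part0 B) ≠ 0)
    (h : ∃ i, IsNest B i ∧ (CondIIi N B i ∨ CondIIii N B i)) :
    insert (uB N B, N) B ∈ P N ∧ Full N (insert (uB N B, N) B) ∧ uB N B < N ∧ uB N B ∉ supp B := by
  obtain ⟨i, hi, hu⟩ := uB_spec h
  set u := uB N B
  have hout := hi.outer_mem hs
  have houtB := (mem_filter.1 hout).1
  have hoN := hB.1.1 _ houtB
  have hoN' : i (2 * #(part0 B)) ≠ N := fun e => hNB (mem_supp.2 ⟨_, houtB, Or.inr e.symm⟩)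
  dsimp only at hoN
  -- An interval spanned by a member of `B¹` meets only members of `B¹`, so it avoids the ends of
  -- the outermost pair of `B⁰`.
  have hnot : ∀ q ∈ part1 B, i 1 ∉ Icc q.1 q.2 ∧ i (2 * #(part0 B)) ∉ Icc q.1 q.2 := by
    intro q hq
    have key : ∀ x ∈ Icc q.1 q.2, ¬ (x = i 1 ∨ x = i (2 * #(part0 B))) := fun x hx hxi => by
      have h1 := (mem_filter.1 ((tile_closed hB hq).2 _ houtB x hx hxi).1).2
      exact Nat.not_even_iff_odd.2 h1 (mem_filter.1 hout).2
    exact ⟨fun h => key _ h (Or.inl rfl), fun h => key _ h (Or.inr rfl)⟩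
  have hrange : 1 ≤ u ∧ u < N := by
    rcases hu with ⟨-, h1, -⟩ | ⟨-, h1, -⟩ <;> rw [mem_Icc] at h1 <;> omega
  -- If `u` were an end of `p`, the other end could not lie in the covered stretches beside `u`, so
  -- `p` would reach or pass the outermost pair of `B⁰`. That is impossible for `p ∈ B⁰` by the
  -- nesting and for `p ∈ B¹` by `hnot`.
  have huB : u ∉ supp B := by
    intro hmem
    obtain ⟨p, hp, hup⟩ := mem_supp.1 hmem
    have hpN := hB.1.1 p hp
    have hp2N : p.2 ≠ N := fun e => hNB (mem_supp.2 ⟨p, hp, Or.inr e.symm⟩)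
    have hz : ∀ Y, ZeroCovered B Y → u ∉ Y → p.1 ∉ Y ∧ p.2 ∉ Y := by
      intro Y hY huY
      constructor <;> intro hpY
      · have := hY.mem_of_mem hB hp (Or.inl hpY)
        rcases hup with e | e <;> rw [e] at huY <;> tauto
      · have := hY.mem_of_mem hB hp (Or.inr hpY)
        rcases hup with e | e <;> rw [e] at huY <;> tauto
    rcases hu with ⟨-, h1, h2, h3⟩ | ⟨-, h1, h2, h3⟩
    · have h2 := hz _ h2 (by rw [mem_Icc]; omega)
      have h3 := hz _ h3 (by rw [mem_Icc]; omega)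
      simp only [mem_Icc] at h1 h2 h3
      rcases part0_or_part1 hp with hp' | hp'
      · have := hi.le_of_mem hp'; omega
      · have := (hnot p hp').1
        rw [mem_Icc] at this; omega
    · have h2 := hz _ h2 (by rw [mem_Icc]; omega)
      have h3 := hz _ h3 (by rw [mem_Icc]; omega)
      simp only [mem_Icc] at h1 h2 h3
      rcases part0_or_part1 hp with hp' | hp'
      · have := hi.le_of_mem hp'; omega
      · have := (hnot p hp').2
        rw [mem_Icc] at this; omega
  refine ⟨insert_mem_P hB.1 hrange.1 hrange.2 le_rfl huB hNB, ?_, hrange.2, huB⟩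
  set S := supp (insert (u, N) B) with hS
  have hSB : supp B ⊆ S := by rw [hS, supp_insert]; exact subset_union_right
  have huS : u ∈ S := by rw [hS, supp_insert]; simp
  have hNS : N ∈ S := by rw [hS, supp_insert]; simp
  have hsides : Icc 1 (i 1 - 1) ⊆ S ∧ Icc (i (2 * #(part0 B)) + 1) N ⊆ S ∧
      bracket N (u, N) ⊆ S := by
    rcases hu with ⟨h0, h1, h2, h3⟩ | ⟨h0, h1, h2, h3⟩
    · have hpar := h2.even_card
      have hz0 := (h0.2.subset_supp hB).trans hSB
      have hz2 := (h2.subset_supp hB).trans hSB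
      have hz3 := (h3.subset_supp hB).trans hSB
      rw [Nat.card_Icc] at hpar
      rw [mem_Icc] at h1
      refine ⟨fun x hx => ?_, fun x hx => ?_, fun x hx => ?_⟩
      · rw [mem_Icc] at hx
        rcases lt_trichotomy x u with h | rfl | h
        · exact hz2 (mem_Icc.2 ⟨by omega, by omega⟩)
        · exact huS
        · exact hz3 (mem_Icc.2 ⟨by omega, by omega⟩)
      · rw [mem_Icc] at hx
        rcases eq_or_ne x N with rfl | h
        · exact hNS
        · exact hz0 (mem_Icc.2 ⟨by omega, by omega⟩)
      · have : ¬ Odd (N - u) := by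
          rw [Nat.even_iff] at hpar; rw [Nat.odd_iff] at hN ⊢; omega
        rw [bracket, if_neg this, mem_union, mem_Icc, mem_Icc] at hx
        by_cases hxN : x = N
        · exact hxN ▸ hNS
        by_cases hxu : x = u
        · exact hxu ▸ huS
        dsimp only at hx
        exact hz2 (mem_Icc.2 ⟨by omega, by omega⟩)
    · have hpar := h3.even_card
      have hz0 := (h0.1.subset_supp hB).trans hSB
      have hz2 := (h2.subset_supp hB).trans hSB
      have hz3 := (h3.subset_supp hB).trans hSB
      rw [Nat.card_Icc] at hpar
      rw [mem_Icc] at h1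
      refine ⟨hz0, fun x hx => ?_, fun x hx => ?_⟩
      · rw [mem_Icc] at hx
        rcases eq_or_ne x N with rfl | h'
        · exact hNS
        rcases lt_trichotomy x u with h | rfl | h
        · exact hz2 (mem_Icc.2 ⟨by omega, by omega⟩)
        · exact huS
        · exact hz3 (mem_Icc.2 ⟨by omega, by omega⟩)
      · have : Odd (N - u) := by
          rw [Nat.even_iff] at hpar; rw [Nat.odd_iff] at hN ⊢; omega
        rw [bracket, if_pos this, mem_Icc] at hx
        by_cases hxN : x = N
        · exact hxN ▸ hNS
        by_cases hxu : x = u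
        · exact hxu ▸ huS
        dsimp only at hx
        exact hz3 (mem_Icc.2 ⟨by omega, by omega⟩)
  intro p hp
  rcases mem_insert.1 hp with rfl | hp
  · exact hsides.2.2
  · exact bracket_subset hB hSB
      (fun q hq => outside_subset hB hs hi hSB hsides.1 hsides.2.1 hq) hp

/-- For every `B ∈ 𝒳` there is a matching `M` all of whose arcs are covered such that `'ε(B)` is the
sum of the arcs of `M` and `⟨B⟩ ⊆ ⟨M⟩`. -/
theorem exists_full_matching {N : ℕ} (hN : Odd N) {B : Finset (ℕ × ℕ)} (hB : B ∈ X N) :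
    ∃ M ∈ P N, Full N M ∧ eps N B = setSum M (bracket N) ∧
      ∀ Z, vec Z ∈ spanB B → Z ⊆ supp M ∧ ∀ p ∈ M, (p.1 ∈ Z ↔ p.2 ∈ Z) := by
  by_cases hc : B ∈ XPlus N ∧ #(part0 B) ≠ 0
  · obtain ⟨⟨hP, hNB, h⟩, hs⟩ := hc
    obtain ⟨h1, h2, h3, h4⟩ := insert_uB hN hP hNB hs (h.resolve_left hs).2
    refine ⟨_, h1, h2, ?_, fun Z hZ => ?_⟩
    · have hni : (uB N B, N) ∉ B := fun h => hNB (mem_supp.2 ⟨_, h, Or.inr rfl⟩)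
      have e : setSum (insert (uB N B, N) B) (bracket N)
          = bracket N (uB N B, N) ∆ setSum B (bracket N) := Finset.fold_insert hni
      have hpar : Odd (N - uB N B) ↔ Even (uB N B) := by
        rw [Nat.odd_iff, Nat.even_iff]; rw [Nat.odd_iff] at hN; omega
      rw [e, eps, if_pos ⟨⟨hP, hNB, h⟩, hs⟩, bracket, if_congr hpar rfl rfl]
      split_ifs
      · exact symmDiff_comm _ _
      · have hd : Disjoint (Icc N N) (Icc 1 (uB N B)) := by
          rw [Finset.disjoint_left]
          intro x hx hx'
          rw [mem_Icc] at hx hx'; omega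
        rw [symmDiff_assoc, hd.symmDiff_eq_sup, symmDiff_comm]; rfl
    · obtain ⟨hs1, hs2⟩ := subset_supp_of_mem_spanB hP.1.2 hZ
      refine ⟨hs1.trans (by rw [supp_insert]; exact subset_union_right), fun p hp => ?_⟩
      rcases mem_insert.1 hp with rfl | hp
      · exact iff_of_false (fun h => h4 (hs1 h)) (fun h => hNB (hs1 h))
      · exact hs2 p hp
  · have hPI : B ∈ PStar N ∧ CondI N B := by
      rcases hB with hB | hB
      · exact ⟨hB.1, Or.inl (by_contra fun h => hc ⟨hB, h⟩)⟩
      · exact ⟨hB.1, hB.2.1⟩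
    refine ⟨B, hPI.1.1, full_of_condI hPI.1 hPI.2, ?_,
      fun Z hZ => subset_supp_of_mem_spanB hPI.1.1.2 hZ⟩
    rw [eps, if_neg hc]

/-! ### Monotonicity of heights and antisymmetry. -/

/-- The absolute heights are monotone for `⪯`. -/
theorem abs_height_le_of_leE {N : ℕ} (hN : Odd N) {Z W : Finset ℕ} (h : leE N Z W) {y : ℕ}
    (hy : y ≤ N) : |height N Z y| ≤ |height N W y| := by
  obtain ⟨C, D, rfl, rfl, h⟩ := h
  induction h with
  | refl => exact le_rfl
  | tail _ h ih =>
    rename_i D E _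
    refine ih.trans ?_
    obtain ⟨M, hM, hF, he, hspan⟩ := exists_full_matching hN E.2
    obtain ⟨h1, h2⟩ := hspan _ h
    rw [he]
    exact abs_height_le hN hM hF h1 h2 hy

/-- A relation generated by `leE` and a numerical function that is compatible with `leE` is
antisymmetric. -/
theorem isPartialOrder_of_leE {N : ℕ} (hN : Odd N) {α : Type} (f : α → Finset ℕ)
    (hf : Function.Injective f) (hE : ∀ a, f a ⊆ Icc 1 N ∧ Even #(f a)) (g : α → ℤ)
    (hg : ∀ a b, |height N (f a) 0| ≤ |height N (f b) 0| → g a ≤ g b) :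
    IsPartialOrder α (Relation.ReflTransGen fun a b => leE N (f a) (f b) ∨ g a < g b) := by
  -- Lexicographic monotonicity along a chain: `g` grows strictly, or it stays fixed and then every
  -- step comes from `leE`.
  have key : ∀ a b, Relation.ReflTransGen (fun a b => leE N (f a) (f b) ∨ g a < g b) a b →
      g a < g b ∨ (g a = g b ∧ ∀ y ≤ N, |height N (f a) y| ≤ |height N (f b) y|) := by
    intro a b h
    induction h with
    | refl => exact Or.inr ⟨rfl, fun _ _ => le_rfl⟩
    | tail _ h ih =>
      rename_i b c _
      have hbc : g b < g c ∨ (g b = g c ∧ ∀ y ≤ N, |height N (f b) y| ≤ |height N (f c) y|) := by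
        rcases h with h | h
        · have hm : ∀ y ≤ N, _ := fun y hy => abs_height_le_of_leE hN h hy
          rcases (hg b c (hm 0 (Nat.zero_le N))).lt_or_eq with h' | h'
          · exact Or.inl h'
          · exact Or.inr ⟨h', hm⟩
        · exact Or.inl h
      rcases ih with h1 | ⟨h1, h2⟩ <;> rcases hbc with h3 | ⟨h3, h4⟩
      · exact Or.inl (h1.trans h3)
      · exact Or.inl (h1.trans_eq h3)
      · exact Or.inl (h1.trans_lt h3)
      · exact Or.inr ⟨h1.trans h3, fun y hy => (h2 y hy).trans (h4 y hy)⟩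
  exact
    { refl := fun _ => Relation.ReflTransGen.refl
      trans := fun _ _ _ => Relation.ReflTransGen.trans
      antisymm := fun a b hab hba => by
        rcases key a b hab with h1 | ⟨h1, h2⟩ <;> rcases key b a hba with h3 | ⟨h3, h4⟩
        · exact absurd h3 h1.le.not_gt
        · exact absurd h1 h3.le.not_gt
        · exact absurd h3 h1.le.not_gt
        · exact hf (eq_of_abs_height_eq hN (hE a).1 (hE b).1 (hE a).2 (hE b).2
            fun y hy => le_antisymm (h2 y hy) (h4 y hy)) }

/-! ### Application to the orbit representatives. -/

theorem repPlus_mem {N : ℕ} (hN : Odd N) (h3 : 3 ≤ N) (Y : OrbPlus N) :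
    repPlus hN h3 Y ∈ EPlus' N :=
  (existsUnique_rep_plus hN h3 Y).choose_spec.1.1

theorem repMinus_mem {N : ℕ} (hN : Odd N) (Y : OrbMinus N) : repMinus hN Y ∈ EMinus' N :=
  (existsUnique_rep_minus hN Y).choose_spec.1.1

theorem repPlus_injective {N : ℕ} (hN : Odd N) (h3 : 3 ≤ N) :
    Function.Injective (repPlus hN h3) := fun Y Y' h => by
  rw [← (existsUnique_rep_plus hN h3 Y).choose_spec.1.2,
    ← (existsUnique_rep_plus hN h3 Y').choose_spec.1.2]
  exact congrArg _ (Subtype.ext h)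

theorem repMinus_injective {N : ℕ} (hN : Odd N) :
    Function.Injective (repMinus hN) := fun Y Y' h => by
  rw [← (existsUnique_rep_minus hN Y).choose_spec.1.2,
    ← (existsUnique_rep_minus hN Y').choose_spec.1.2]
  exact congrArg _ (Subtype.ext h)

end OrthBasis

theorem mainTheorem9 (N : ℕ) (hN : Odd N) (hN3 : 3 ≤ N) :
    IsPartialOrder (OrthBasis.OrbPlus N) (OrthBasis.barLEPlus hN hN3) ∧
      IsPartialOrder (OrthBasis.OrbMinus N) (OrthBasis.barLEMinus hN) := by
  constructor
  · refine OrthBasis.isPartialOrder_of_leE hN (OrthBasis.repPlus hN hN3)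
      (OrthBasis.repPlus_injective hN hN3)
      (fun Y => have h := (OrthBasis.repPlus_mem hN hN3 Y).1; ⟨h.1, h.2.1⟩)
      (fun Y => |OrthBasis.gamma (OrthBasis.repPlus hN hN3 Y)|) fun Y Y' h => ?_
    have h1 := OrthBasis.repPlus_mem hN hN3 Y
    have h2 := OrthBasis.repPlus_mem hN hN3 Y'
    -- Here `γ ≤ 0`, and `|1 + 2γ|` takes the value `1` at both `0` and `-1`; evenness of `γ`
    -- excludes `-1`, so `|1 + 2γ|` orders the possible values as `|γ|` does.
    obtain ⟨k, hk⟩ := OrthBasis.even_gamma h1.1.2.1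
    obtain ⟨l, hl⟩ := OrthBasis.even_gamma h2.1.2.1
    rw [OrthBasis.height_zero hN h1.1.1, OrthBasis.height_zero hN h2.1.1] at h
    have h1 := h1.2
    have h2 := h2.2
    have h3 : ∀ a : ℤ, |1 + 2 * a| = 1 + 2 * a ∧ 0 ≤ a ∨ |1 + 2 * a| = -1 - 2 * a ∧ a < 0 := by
      intro a
      rcases le_or_gt 0 a with ha | ha
      · exact Or.inl ⟨abs_of_nonneg (by omega), ha⟩
      · exact Or.inr ⟨by rw [abs_of_nonpos (by omega)]; ring, ha⟩
    have h4 := h3 (OrthBasis.gamma (OrthBasis.repPlus hN hN3 Y))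
    have h5 := h3 (OrthBasis.gamma (OrthBasis.repPlus hN hN3 Y'))
    rw [abs_of_nonpos (by omega), abs_of_nonpos (by omega)]
    omega
  · refine OrthBasis.isPartialOrder_of_leE hN (OrthBasis.repMinus hN)
      (OrthBasis.repMinus_injective hN)
      (fun Y => have h := (OrthBasis.repMinus_mem hN Y).1; ⟨h.1, h.2.1⟩)
      (fun Y => |OrthBasis.gamma (OrthBasis.repMinus hN Y) + 1|) fun Y Y' h => ?_
    have h1 := OrthBasis.repMinus_mem hN Y
    have h2 := OrthBasis.repMinus_mem hN Y'
    rw [OrthBasis.height_zero hN h1.1.1, OrthBasis.height_zero hN h2.1.1] at h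
    have h1 := h1.2
    have h2 := h2.2
    -- Since `γ ≥ 0`, both `|1 + 2γ|` and `|γ + 1|` increase with `γ`.
    rw [abs_of_nonneg (by omega), abs_of_nonneg (by omega)] at h ⊢
    omega
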